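/- For $r,s,n\in\mathbb N$ with $1\le s\le n$ and $r\ge 1$, let $\Sigma_{s,r}$ be the set of all $Z\in\mathbb R^{n\times n}$ with $\operatorname{rank}(Z)\le r$ for which there are index sets $S,T\subseteq\{1,\dots,n\}$ with $|S|=|T|=s$ such that $Z_{k,l}=0$ whenever $k\notin S$ or $l\notin T$. A Gaussian random map is a map $\mathcal A:\mathbb R^{n\times n}\to\mathbb R^m$, $\mathcal A(Z)=(\langle A_i,Z\rangle_F)_{i=1}^m$, where $\langle A,Z\rangle_F=\operatorname{tr}(A^\top Z)$ and the $n\times n$ random matrices $A_1,\dots,A_m$ are independent, each with independent $\mathcal N(0,1)$ entries. **Theorem.** There are absolute constants $C,c>0$ such that the following holds for all $n,m,r,s$ as above, every Gaussian random map $\mathcal A:\mathbb R^{n\times n}\to\mathbb R^m$ and every $\delta\in(0,1)$. If $$\text{(a)}\quad s\le \frac n2\ \text{ and }\ m\ge \frac{C}{\delta^{2}}\,rs\ln\Big(\frac ns\Big),\qquad\text{or}\qquad\text{(b)}\quad m\ge \frac{C}{\delta^{2}}\,rs\ln\Big(\frac{en}{s}\Big),$$ then, with probability at least $1-2\exp(-c\,\delta^2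 m)$, one has for all $Z\in\Sigma_{s,r}$ simultaneously $$(1-\delta)\,\|Z\|_F\ \le\ \frac{\sqrt{\pi/2}}{m}\,\|\mathcal A(Z)\|_1\ \le\ (1+\delta)\,\|Z\|_F .$$ -/

import Mathlib

open MeasureTheory ProbabilityTheory

open scoped Matrix Matrix.Norms.Frobenius

/-- The set `Σ_{s,r}` of real `n × n` matrices that have rank at most `r` and are supported on
`S × T` for some index sets `S`, `T` of size `s`. -/
def bisparseLowRank (n s r : ℕ) : Set (Matrix (Fin n) (Fin n) ℝ) :=
  {X | X.rank ≤ r ∧ ∃ S T : Finset (Fin n), S.card = s ∧ T.card = s ∧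
    (∀ i, i ∉ S → ∀ j, X i j = 0) ∧ (∀ i j, j ∉ T → X i j = 0)}

/-- The linear map `M ↦ (⟨A i, M⟩_F)_i`, where `⟨A, M⟩_F = tr (Aᵀ M)` is the Frobenius inner
product. -/
def sensingMap {n m : ℕ} (A : Fin m → Matrix (Fin n) (Fin n) ℝ) :
    Matrix (Fin n) (Fin n) ℝ →ₗ[ℝ] (Fin m → ℝ) where
  toFun M := fun i => ((A i)ᵀ * M).trace
  map_add' M N := by
    funext i
    simp [Matrix.mul_add]
  map_smul' a M := by
    funext i
    simp

/-- The random matrices `A 0, …, A (m - 1)` are independent standard Gaussian matrices: all their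
entries together form an independent family of `N(0,1)` random variables. -/
structure IsGaussianSensing {Ω : Type*} [MeasurableSpace Ω] (μ : Measure Ω) {n m : ℕ}
    (A : Fin m → Ω → Matrix (Fin n) (Fin n) ℝ) : Prop where
  hasLaw : ∀ i k l, HasLaw (fun ω => A i ω k l) (gaussianReal 0 1) μ
  indep : iIndepFun (fun (q : Fin m × Fin n × Fin n) (ω : Ω) => A q.1 ω q.2.1 q.2.2) μ

/-- The restricted isometry property on `Σ_{s,r}`, from the Frobenius norm to the `ℓ¹` norm scaled
by `√(π/2) / m`. The norm of `Z` is the Frobenius norm. -/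
def SatisfiesRIP {n m : ℕ} (𝒜 : Matrix (Fin n) (Fin n) ℝ →ₗ[ℝ] (Fin m → ℝ)) (s r : ℕ) (δ : ℝ) :
    Prop :=
  ∀ Z ∈ bisparseLowRank n s r,
    (1 - δ) * ‖Z‖ ≤ √(Real.pi / 2) / m * ‖WithLp.toLp 1 (𝒜 Z)‖ ∧
      √(Real.pi / 2) / m * ‖WithLp.toLp 1 (𝒜 Z)‖ ≤ (1 + δ) * ‖Z‖

/-!
For each `Z` the quantity `‖𝒜 Z‖₁` is a sum of `m` independent copies of `|⟪G, Z⟫|`, with mean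
`√(2/π) m ‖Z‖`, so the theorem asserts uniform concentration over the cone `Σ_{s,r}`. The
exponential moment of the supremum of the centred sums is bounded in three steps: symmetrization
introduces random signs, a contraction argument then removes the absolute values, and by symmetry
of the Gaussian law the signs disappear again, which leaves the supremum of the *linear* process
`Z ↦ ∑ i, ⟪G i, Z⟫`.

A linear functional on the unit ball is controlled by its maximum over a `1/2`-net, so a net of
fixed resolution suffices and no `ln (1/δ)` is lost. The matrices of rank at most `r` in the unit
ball of a block `S × T` are products of two factors in unit balls of dimension `r s`, and
a linear functional of the product is linear in each factor. So `5 ^ (2 r s)` points per block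
suffice, and `(n choose s) ^ 2` blocks cover `Σ_{s,r}`. The two conditions on `m` make
`exp (-c δ² m)` beat this cardinality.
-/

/-- Every linear functional at a point of `T` is at most `K` times its value at some point of `N`.
For finite `N` this says that `T ⊆ K • conv N`. -/
def IsNorming {X : Type*} [AddCommGroup X] [Module ℝ X] (K : ℝ) (N T : Set X) : Prop :=
  ∀ φ : X →ₗ[ℝ] ℝ, ∀ u ∈ T, ∃ v ∈ N, φ u ≤ K * φ v

namespace IsNorming

variable {X Y Z : Type*} [AddCommGroup X] [Module ℝ X] [AddCommGroup Y] [Module ℝ Y]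
  [AddCommGroup Z] [Module ℝ Z] {K L : ℝ} {N N' T T' : Set X}

theorem mono (h : IsNorming K N T) (hN : N ⊆ N') (hT : T' ⊆ T) : IsNorming K N' T' :=
  fun φ u hu => (h φ u (hT hu)).imp fun _ hv => ⟨hN hv.1, hv.2⟩

theorem iUnion₂ {ι : Type*} {I : Set ι} {A B : ι → Set X}
    (h : ∀ i ∈ I, IsNorming K (A i) (B i)) : IsNorming K (⋃ i ∈ I, A i) (⋃ i ∈ I, B i) := by
  intro φ u hu
  obtain ⟨i, hi, hu⟩ := Set.mem_iUnion₂.1 hu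
  obtain ⟨v, hv, hle⟩ := h i hi φ u hu
  exact ⟨v, Set.mem_iUnion₂.2 ⟨i, hi, hv⟩, hle⟩

theorem image (f : X →ₗ[ℝ] Y) (h : IsNorming K N T) : IsNorming K (f '' N) (f '' T) := by
  rintro φ _ ⟨u, hu, rfl⟩
  obtain ⟨v, hv, hle⟩ := h (φ ∘ₗ f) u hu
  exact ⟨f v, Set.mem_image_of_mem f hv, hle⟩

theorem image2 (f : X →ₗ[ℝ] Y →ₗ[ℝ] Z) {M S : Set Y} (hK : 0 ≤ K) (hN : IsNorming K N T)
    (hM : IsNorming L M S) :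
    IsNorming (K * L) (Set.image2 (fun x y => f x y) N M) (Set.image2 (fun x y => f x y) T S) := by
  rintro φ _ ⟨u, hu, w, hw, rfl⟩
  obtain ⟨v, hv, huv⟩ := hN (φ ∘ₗ f.flip w) u hu
  obtain ⟨z, hz, hwz⟩ := hM (φ ∘ₗ f v) w hw
  refine ⟨f v z, Set.mem_image2_of_mem hv hz, ?_⟩
  calc φ (f u w) ≤ K * φ (f v w) := huv
    _ ≤ K * (L * φ (f v z)) := mul_le_mul_of_nonneg_left hwz hK
    _ = K * L * φ (f v z) := (mul_assoc _ _ _).symm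

end IsNorming

section UnitBall

open Metric

variable {X : Type*} [NormedAddCommGroup X] [NormedSpace ℝ X] [FiniteDimensional ℝ X]

theorem isNorming_closedBall_of_isCover {θ : NNReal} (hθ : θ < 1) {N : Set X} (hN : N.Finite)
    (hcover : IsCover θ (closedBall 0 1) N) :
    IsNorming (1 - θ : ℝ)⁻¹ N (closedBall 0 1) := by
  intro φ u hu
  have hnet : ∀ x ∈ closedBall (0 : X) 1, ∃ c ∈ N, ‖x - c‖ ≤ θ := fun x hx => by
    simpa [dist_eq_norm] using isCover_iff_subset_iUnion_closedBall.1 hcover hx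
  obtain ⟨v₀, hv₀, -⟩ := hnet u hu
  obtain ⟨v, hv, hmax⟩ := N.exists_max_image φ hN ⟨v₀, hv₀⟩
  refine ⟨v, hv, ?_⟩
  let f : X →L[ℝ] ℝ := φ.toContinuousLinearMap
  have hball : ∀ x, ‖x‖ ≤ 1 → f x ≤ φ v + ‖f‖ * θ := by
    intro x hx
    obtain ⟨c, hc, hxc⟩ := hnet x (mem_closedBall_zero_iff.2 hx)
    calc f x = f c + f (x - c) := by rw [map_sub, add_sub_cancel]
      _ ≤ φ v + ‖f‖ * θ :=
        add_le_add (hmax c hc) ((le_abs_self _).trans (f.le_opNorm_of_le hxc))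
  have hnorm : ‖f‖ ≤ φ v + ‖f‖ * θ := by
    refine f.opNorm_le_of_unit_norm ?_ fun x hx => abs_le'.2 ⟨hball x hx.le, ?_⟩
    · simpa using hball 0 (by simp)
    · simpa using hball (-x) (by simp [hx])
  have hθ' : (0 : ℝ) < 1 - θ := sub_pos.2 (by exact_mod_cast hθ)
  calc φ u ≤ ‖f‖ := (le_abs_self _).trans
        (f.unit_le_opNorm u (mem_closedBall_zero_iff.1 hu))
    _ ≤ (1 - θ : ℝ)⁻¹ * φ v := by
      rw [le_inv_mul_iff₀ hθ']
      linarith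

variable (X) in
theorem packingNumber_closedBall_le :
    packingNumber (1 / 2) (closedBall (0 : X) 1) ≤ (5 ^ Module.finrank ℝ X : ℕ) := by
  classical
  refine iSup_le fun C => iSup₂_le fun hC hsep => ?_
  by_contra! hlt
  obtain ⟨t, htC, ht⟩ := Set.exists_subset_encard_eq
    (k := (5 ^ Module.finrank ℝ X + 1 : ℕ)) (by exact_mod_cast Order.add_one_le_of_lt hlt)
  obtain ⟨t, rfl⟩ := (Set.finite_of_encard_eq_coe ht).exists_finset_coe
  have hcard : (t.image fun c => (2 : ℝ) • c).card = t.card :=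
    Finset.card_image_of_injective t (smul_right_injective X two_ne_zero)
  have hle := Besicovitch.card_le_of_separated (t.image fun c => (2 : ℝ) • c) ?_ ?_
  · rw [Set.encard_coe_eq_coe_finsetCard] at ht
    norm_cast at ht
    omega
  · intro c hc
    obtain ⟨c, hct, rfl⟩ := Finset.mem_image.1 hc
    have := mem_closedBall_zero_iff.1 (hC (htC hct))
    rw [norm_smul, Real.norm_two]
    linarith
  · intro c hc d hd hcd
    obtain ⟨c, hct, rfl⟩ := Finset.mem_image.1 hc
    obtain ⟨d, hdt, rfl⟩ := Finset.mem_image.1 hd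
    have hlt : _ < edist c d := hsep (htC hct) (htC hdt) fun h => hcd (congrArg _ h)
    rw [edist_nndist, ENNReal.coe_lt_coe, ← NNReal.coe_lt_coe, coe_nndist, dist_eq_norm] at hlt
    rw [← smul_sub, norm_smul, Real.norm_two]
    norm_num at hlt
    linarith

variable (X) in
theorem exists_isNorming_closedBall :
    ∃ N : Finset X, N.card ≤ 5 ^ Module.finrank ℝ X ∧ (N : Set X) ⊆ closedBall 0 1 ∧
      IsNorming 2 (N : Set X) (closedBall 0 1) := by
  have htop : packingNumber (1 / 2) (closedBall (0 : X) 1) ≠ ⊤ :=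
    ne_top_of_le_ne_top (ENat.natCast_ne_top _) (packingNumber_closedBall_le X)
  have hcard := (encard_maximalSeparatedSet htop).trans_le (packingNumber_closedBall_le X)
  have hfin := Set.finite_of_encard_le_coe hcard
  refine ⟨hfin.toFinset, ?_, by simpa using maximalSeparatedSet_subset, ?_⟩
  · rwa [hfin.encard_eq_coe_toFinset_card, Nat.cast_le] at hcard
  · have hnorming := isNorming_closedBall_of_isCover (by norm_num) hfin
      (isCover_maximalSeparatedSet htop)
    norm_num at hnorming
    simpa using hnorming

end UnitBall

section Frobenius

variable {α β ρ : Type*} [Fintype α]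

/-- The bilinear map applying a linear map `U` to every column of a matrix `W`. It is the matrix
product, with the operator norm on the left factor. -/
def columnMap : (EuclideanSpace ℝ ρ →L[ℝ] EuclideanSpace ℝ α) →ₗ[ℝ] Matrix ρ β ℝ →ₗ[ℝ]
    Matrix α β ℝ :=
  LinearMap.mk₂ ℝ (fun U W => Matrix.of fun i j => U (WithLp.toLp 2 (W.col j)) i)
    (fun _ _ _ => rfl) (fun _ _ _ => rfl)
    (fun U W W' => by
      ext i j
      exact congrArg (· i) (U.map_add (WithLp.toLp 2 (W.col j)) (WithLp.toLp 2 (W'.col j))))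
    (fun c U W => by
      ext i j
      exact congrArg (· i) (U.map_smul c (WithLp.toLp 2 (W.col j))))

theorem toLp_col_columnMap (U : EuclideanSpace ℝ ρ →L[ℝ] EuclideanSpace ℝ α) (W : Matrix ρ β ℝ)
    (j : β) : WithLp.toLp 2 ((columnMap U W).col j) = U (WithLp.toLp 2 (W.col j)) := rfl

variable [Fintype β] [Fintype ρ]

theorem frobenius_norm_sq_eq_sum (Z : Matrix α β ℝ) : ‖Z‖ ^ 2 = ∑ i, ∑ j, Z i j ^ 2 := by
  rw [Matrix.frobenius_norm_def, ← Real.rpow_natCast, ← Real.rpow_mul (by positivity)]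
  simp

theorem frobenius_norm_sq_eq_sum_norm_col_sq (Z : Matrix α β ℝ) :
    ‖Z‖ ^ 2 = ∑ j, ‖WithLp.toLp 2 (Z.col j)‖ ^ 2 := by
  simp only [frobenius_norm_sq_eq_sum, EuclideanSpace.real_norm_sq_eq, Matrix.col_apply]
  exact Finset.sum_comm

theorem norm_columnMap_le (U : EuclideanSpace ℝ ρ →L[ℝ] EuclideanSpace ℝ α) (W : Matrix ρ β ℝ) :
    ‖columnMap U W‖ ≤ ‖U‖ * ‖W‖ := by
  refine le_of_sq_le_sq ?_ (by positivity)
  calc ‖columnMap U W‖ ^ 2 = ∑ j, ‖U (WithLp.toLp 2 (W.col j))‖ ^ 2 := by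
        simp only [frobenius_norm_sq_eq_sum_norm_col_sq, toLp_col_columnMap]
    _ ≤ ∑ j, (‖U‖ * ‖WithLp.toLp 2 (W.col j)‖) ^ 2 := by
        gcongr
        exact U.le_opNorm _
    _ = (‖U‖ * ‖W‖) ^ 2 := by
        simp only [mul_pow, frobenius_norm_sq_eq_sum_norm_col_sq, Finset.mul_sum]

end Frobenius

section LowRank

theorem exists_linearIsometry_euclideanSpace {V : Type*} [NormedAddCommGroup V]
    [InnerProductSpace ℝ V] [FiniteDimensional ℝ V] {r : ℕ} (h : Module.finrank ℝ V ≤ r) :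
    Nonempty (V →ₗᵢ[ℝ] EuclideanSpace ℝ (Fin r)) := by
  let b := stdOrthonormalBasis ℝ V
  let c := EuclideanSpace.basisFun (Fin r) ℝ
  let f := b.toBasis.constr ℝ fun i => c (Fin.castLE h i)
  have hf : f ∘ b.toBasis = c ∘ Fin.castLE h := by
    funext i
    simp [f]
  refine ⟨f.isometryOfOrthonormal (v := b.toBasis) (by simp) ?_⟩
  rw [hf]
  exact c.orthonormal.comp _ (Fin.castLE_injective h)

theorem exists_contraction_comp_eq_of_finrank_range_le {E F : Type*} [AddCommGroup E] [Module ℝ E]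
    [NormedAddCommGroup F] [InnerProductSpace ℝ F] [FiniteDimensional ℝ F] {r : ℕ} (f : E →ₗ[ℝ] F)
    (h : Module.finrank ℝ f.range ≤ r) :
    ∃ (U : EuclideanSpace ℝ (Fin r) →L[ℝ] F) (w : E →ₗ[ℝ] EuclideanSpace ℝ (Fin r)),
      ‖U‖ ≤ 1 ∧ (∀ x, ‖w x‖ = ‖f x‖) ∧ ∀ x, U (w x) = f x := by
  obtain ⟨i⟩ := exists_linearIsometry_euclideanSpace h
  let j := i.toContinuousLinearMap
  refine ⟨f.range.subtypeL ∘L ContinuousLinearMap.adjoint j, i.toLinearMap ∘ₗ f.rangeRestrict,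
    ?_, fun x => i.norm_map _, fun x => ?_⟩
  · refine (ContinuousLinearMap.opNorm_comp_le _ _).trans ?_
    rw [LinearIsometryEquiv.norm_map]
    exact mul_le_one₀ (Submodule.norm_subtypeL_le _) (norm_nonneg _) i.norm_toContinuousLinearMap_le
  · have hadj : ContinuousLinearMap.adjoint j ∘L j = ContinuousLinearMap.id ℝ f.range :=
      (ContinuousLinearMap.norm_map_iff_adjoint_comp_self j).1 i.norm_map
    exact congrArg Subtype.val (DFunLike.congr_fun hadj (f.rangeRestrict x))

theorem finrank_range_toEuclideanLin {α β : Type*} [Finite α] [Fintype β] [DecidableEq β]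
    (Z : Matrix α β ℝ) : Module.finrank ℝ (Matrix.toEuclideanLin Z).range = Z.rank := by
  have := Fintype.ofFinite α
  rw [Matrix.rank_eq_finrank_range_toLin Z (EuclideanSpace.basisFun α ℝ).toBasis
    (EuclideanSpace.basisFun β ℝ).toBasis, Matrix.toEuclideanLin_eq_toLin_orthonormal]

variable {α β : Type*} [Fintype α] [Fintype β] {r : ℕ}

theorem exists_columnMap_eq_of_rank_le {Z : Matrix α β ℝ} (h : Z.rank ≤ r) :
    ∃ (U : EuclideanSpace ℝ (Fin r) →L[ℝ] EuclideanSpace ℝ α) (W : Matrix (Fin r) β ℝ),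
      ‖U‖ ≤ 1 ∧ ‖W‖ = ‖Z‖ ∧ columnMap U W = Z := by
  classical
  obtain ⟨U, w, hU, hw, hUw⟩ := exists_contraction_comp_eq_of_finrank_range_le
    (Matrix.toEuclideanLin Z) ((finrank_range_toEuclideanLin Z).trans_le h)
  have hcol (j : β) :
      Matrix.toEuclideanLin Z (WithLp.toLp 2 (Pi.single j 1)) = WithLp.toLp 2 (Z.col j) := by
    rw [Matrix.toLpLin_toLp, Matrix.toLin'_apply, Matrix.mulVec_single_one]
  let W : Matrix (Fin r) β ℝ := Matrix.of fun k j => w (WithLp.toLp 2 (Pi.single j 1)) k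
  have hW (j : β) : WithLp.toLp 2 (W.col j) = w (WithLp.toLp 2 (Pi.single j 1)) := rfl
  refine ⟨U, W, hU, ?_, ?_⟩
  · rw [← sq_eq_sq₀ (norm_nonneg _) (norm_nonneg _)]
    simp only [frobenius_norm_sq_eq_sum_norm_col_sq, hW, hw, hcol]
  · ext i j
    exact congrArg (· i) ((congrArg U (hW j)).trans ((hUw _).trans (hcol j)))

open Metric

variable (α β r) in
theorem exists_isNorming_rank_le :
    ∃ N : Finset (Matrix α β ℝ), N.card ≤ 5 ^ (r * (Fintype.card α + Fintype.card β)) ∧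
      (N : Set (Matrix α β ℝ)) ⊆ closedBall 0 1 ∧
      IsNorming 4 (N : Set (Matrix α β ℝ)) ({Z | Z.rank ≤ r} ∩ closedBall 0 1) := by
  classical
  obtain ⟨N, hNcard, hNball, hN⟩ :=
    exists_isNorming_closedBall (EuclideanSpace ℝ (Fin r) →L[ℝ] EuclideanSpace ℝ α)
  obtain ⟨M, hMcard, hMball, hM⟩ := exists_isNorming_closedBall (Matrix (Fin r) β ℝ)
  refine ⟨Finset.image₂ (fun U W => columnMap U W) N M, ?_, ?_, ?_⟩
  · have hfinrank : Module.finrank ℝ (EuclideanSpace ℝ (Fin r) →L[ℝ] EuclideanSpace ℝ α) =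
        r * Fintype.card α := by
      rw [← LinearMap.toContinuousLinearMap.finrank_eq, Module.finrank_linearMap,
        finrank_euclideanSpace_fin, finrank_euclideanSpace]
    rw [hfinrank] at hNcard
    rw [Module.finrank_matrix, Fintype.card_fin, Module.finrank_self, mul_one] at hMcard
    rw [mul_add, pow_add]
    exact (Finset.card_image₂_le _ _ _).trans (Nat.mul_le_mul hNcard hMcard)
  · rw [Finset.coe_image₂, Set.image2_subset_iff]
    intro U hU W hW
    have hU := mem_closedBall_zero_iff.1 (hNball hU)
    have hW := mem_closedBall_zero_iff.1 (hMball hW)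
    exact mem_closedBall_zero_iff.2
      ((norm_columnMap_le U W).trans (mul_le_one₀ hU (norm_nonneg _) hW))
  · rw [Finset.coe_image₂, show (4 : ℝ) = 2 * 2 by norm_num]
    refine (hN.image2 columnMap zero_le_two hM).mono subset_rfl ?_
    rintro Z ⟨hr, hZ⟩
    obtain ⟨U, W, hU, hW, rfl⟩ := exists_columnMap_eq_of_rank_le hr
    exact ⟨U, mem_closedBall_zero_iff.2 hU, W, by simpa [hW] using hZ, rfl⟩

end LowRank

section Support

variable {α β : Type*}

/-- The matrices that vanish outside the block `S × T`. -/
def supportedMatrices (S : Finset α) (T : Finset β) : Set (Matrix α β ℝ) :=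
  {Z | (∀ i, i ∉ S → ∀ j, Z i j = 0) ∧ ∀ i j, j ∉ T → Z i j = 0}

/-- Extension of an `S × T` block by zero. -/
def extendBlock [DecidableEq α] [DecidableEq β] (S : Finset α) (T : Finset β) :
    Matrix S T ℝ →ₗ[ℝ] Matrix α β ℝ where
  toFun Z := Matrix.of fun i j => if h : i ∈ S ∧ j ∈ T then Z ⟨i, h.1⟩ ⟨j, h.2⟩ else 0
  map_add' Y Z := by ext; simp only [Matrix.of_apply, Matrix.add_apply]; split_ifs <;> simp
  map_smul' a Z := by ext; simp only [Matrix.of_apply, Matrix.smul_apply]; split_ifs <;> simp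

section extendBlock

variable [DecidableEq α] [DecidableEq β] {S : Finset α} {T : Finset β}

theorem extendBlock_mem_supportedMatrices (Y : Matrix S T ℝ) :
    extendBlock S T Y ∈ supportedMatrices S T :=
  ⟨fun _ hi _ => dif_neg fun h => hi h.1, fun _ _ hj => dif_neg fun h => hj h.2⟩

theorem submatrix_extendBlock (Y : Matrix S T ℝ) :
    (extendBlock S T Y).submatrix Subtype.val Subtype.val = Y := by
  ext i j
  exact dif_pos ⟨i.2, j.2⟩

theorem extendBlock_submatrix_of_mem_supportedMatrices {Z : Matrix α β ℝ}
    (hZ : Z ∈ supportedMatrices S T) :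
    extendBlock S T (Z.submatrix Subtype.val Subtype.val) = Z := by
  ext i j
  change dite (i ∈ S ∧ j ∈ T) _ _ = _
  split_ifs with h
  · rfl
  · rcases not_and_or.1 h with hi | hj
    exacts [(hZ.1 i hi j).symm, (hZ.2 i j hj).symm]

end extendBlock

variable [Fintype α] [Fintype β]

theorem norm_submatrix_of_mem_supportedMatrices {S : Finset α} {T : Finset β} {Z : Matrix α β ℝ}
    (hZ : Z ∈ supportedMatrices S T) :
    ‖(Z.submatrix Subtype.val Subtype.val : Matrix S T ℝ)‖ = ‖Z‖ := by
  have hrow : ∀ i, ∑ j ∈ T, Z i j ^ 2 = ∑ j, Z i j ^ 2 := fun i =>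
    Finset.sum_subset T.subset_univ fun j _ hj => by rw [hZ.2 i j hj, zero_pow two_ne_zero]
  rw [← sq_eq_sq₀ (norm_nonneg _) (norm_nonneg _)]
  simp only [frobenius_norm_sq_eq_sum, Matrix.submatrix_apply]
  calc ∑ i : S, ∑ j : T, Z i j ^ 2 = ∑ i ∈ S, ∑ j ∈ T, Z i j ^ 2 := by
        rw [← Finset.sum_coe_sort S]
        exact Finset.sum_congr rfl fun i _ => Finset.sum_coe_sort T fun j => Z i j ^ 2
    _ = ∑ i, ∑ j, Z i j ^ 2 := by
        simp only [hrow]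
        exact Finset.sum_subset S.subset_univ fun i _ hi => by simp [hZ.1 i hi]

theorem norm_extendBlock [DecidableEq α] [DecidableEq β] {S : Finset α} {T : Finset β}
    (Y : Matrix S T ℝ) : ‖extendBlock S T Y‖ = ‖Y‖ := by
  rw [← norm_submatrix_of_mem_supportedMatrices (extendBlock_mem_supportedMatrices Y),
    submatrix_extendBlock]

open Metric

theorem exists_isNorming_rank_le_inter_supportedMatrices (r : ℕ) (S : Finset α) (T : Finset β) :
    ∃ N : Finset (Matrix α β ℝ), N.card ≤ 5 ^ (r * (S.card + T.card)) ∧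
      (N : Set (Matrix α β ℝ)) ⊆ closedBall 0 1 ∧
      IsNorming 4 (N : Set (Matrix α β ℝ))
        ({Z | Z.rank ≤ r} ∩ supportedMatrices S T ∩ closedBall 0 1) := by
  classical
  obtain ⟨N, hcard, hball, hN⟩ := exists_isNorming_rank_le S T r
  rw [Fintype.card_coe, Fintype.card_coe] at hcard
  refine ⟨N.image (extendBlock S T), Finset.card_image_le.trans hcard, ?_, ?_⟩
  · rw [Finset.coe_image, Set.image_subset_iff]
    intro Y hY
    simpa [norm_extendBlock] using hball hY
  · rw [Finset.coe_image]
    refine (hN.image (extendBlock S T)).mono subset_rfl ?_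
    rintro Z ⟨⟨hr, hZ⟩, hball⟩
    refine ⟨_, ⟨(Z.rank_submatrix_le _ _).trans hr, ?_⟩,
      extendBlock_submatrix_of_mem_supportedMatrices hZ⟩
    rw [mem_closedBall_zero_iff] at hball ⊢
    rwa [norm_submatrix_of_mem_supportedMatrices hZ]

theorem bisparseLowRank_eq_iUnion₂ (n s r : ℕ) :
    bisparseLowRank n s r =
      ⋃ p ∈ (Finset.univ.powersetCard s ×ˢ Finset.univ.powersetCard s :
        Finset (Finset (Fin n) × Finset (Fin n))),
        {Z | Z.rank ≤ r} ∩ supportedMatrices p.1 p.2 := by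
  ext Z
  simp only [Set.mem_iUnion₂, Finset.mem_product, Finset.mem_powersetCard_univ, Prod.exists]
  exact ⟨fun ⟨hr, S, T, hS, hT, hZ⟩ => ⟨S, T, ⟨hS, hT⟩, hr, hZ⟩,
    fun ⟨S, T, ⟨hS, hT⟩, hr, hZ⟩ => ⟨hr, S, T, hS, hT, hZ⟩⟩

theorem exists_isNorming_bisparseLowRank (n s r : ℕ) :
    ∃ N : Finset (Matrix (Fin n) (Fin n) ℝ),
      N.card ≤ n.choose s ^ 2 * 5 ^ (r * (s + s)) ∧
      (N : Set (Matrix (Fin n) (Fin n) ℝ)) ⊆ closedBall 0 1 ∧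
      IsNorming 4 (N : Set (Matrix (Fin n) (Fin n) ℝ))
        (bisparseLowRank n s r ∩ closedBall 0 1) := by
  classical
  let P : Finset (Finset (Fin n) × Finset (Fin n)) :=
    Finset.univ.powersetCard s ×ˢ Finset.univ.powersetCard s
  choose N hcard hball hN using fun p : Finset (Fin n) × Finset (Fin n) =>
    exists_isNorming_rank_le_inter_supportedMatrices r p.1 p.2
  refine ⟨P.biUnion N, ?_, ?_, ?_⟩
  · have hP : P.card = n.choose s ^ 2 := by simp [P, sq]
    rw [← hP]
    refine Finset.card_biUnion_le_card_mul _ _ _ fun p hp => (hcard p).trans_eq ?_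
    obtain ⟨hS, hT⟩ := Finset.mem_product.1 hp
    rw [(Finset.mem_powersetCard.1 hS).2, (Finset.mem_powersetCard.1 hT).2]
  · rw [Finset.coe_biUnion]
    exact Set.iUnion₂_subset fun p _ => hball p
  · rw [Finset.coe_biUnion, bisparseLowRank_eq_iUnion₂, Set.iUnion₂_inter]
    exact IsNorming.iUnion₂ fun p _ => hN p

end Support

theorem ofReal_exp_integral_le {Ω : Type*} [MeasurableSpace Ω] {μ : Measure Ω}
    [IsProbabilityMeasure μ] {f : Ω → ℝ} (hf : Integrable f μ) :
    ENNReal.ofReal (Real.exp (∫ x, f x ∂μ)) ≤ ∫⁻ x, ENNReal.ofReal (Real.exp (f x)) ∂μ := by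
  by_cases hexp : Integrable (fun x => Real.exp (f x)) μ
  · rw [← ofReal_integral_eq_lintegral_ofReal hexp (.of_forall fun _ => (Real.exp_pos _).le)]
    exact ENNReal.ofReal_le_ofReal (convexOn_exp.map_integral_le Real.continuous_exp.continuousOn
      isClosed_univ (.of_forall fun _ => Set.mem_univ _) hf hexp)
  · have htop : ∫⁻ x, ENNReal.ofReal (Real.exp (f x)) ∂μ = ⊤ := by
      by_contra h
      refine hexp ⟨Real.continuous_exp.comp_aestronglyMeasurable hf.1, ?_⟩
      rw [hasFiniteIntegral_iff_ofReal (.of_forall fun _ => (Real.exp_pos _).le)]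
      exact Ne.lt_top h
    exact le_top.trans_eq htop.symm

/-- The exponential `exp (sup_k g k)` of the supremum of a family, with value `∞` when `g` is
unbounded. -/
noncomputable def supExp {κ : Type*} (g : κ → ℝ) : ENNReal :=
  ⨆ k, ENNReal.ofReal (Real.exp (g k))

section SupExp

variable {κ : Type*}

theorem ofReal_exp_le_supExp (g : κ → ℝ) (k : κ) : ENNReal.ofReal (Real.exp (g k)) ≤ supExp g :=
  le_iSup (fun k => ENNReal.ofReal (Real.exp (g k))) k

theorem two_mul_supExp_sub_le (p q : κ → ℝ) :
    2 * supExp (fun k => p k - q k) ≤ supExp (fun k => 2 * p k) + supExp (fun k => -(2 * q k)) := by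
  rw [supExp, ENNReal.mul_iSup]
  refine iSup_le fun k => ?_
  have hexp : 2 * Real.exp (p k - q k) ≤ Real.exp (2 * p k) + Real.exp (-(2 * q k)) := by
    have h := two_mul_le_add_sq (Real.exp (p k)) (Real.exp (-q k))
    rwa [mul_assoc, ← Real.exp_add, ← sub_eq_add_neg, ← Real.exp_nat_mul, ← Real.exp_nat_mul,
      Nat.cast_two, mul_neg] at h
  calc 2 * ENNReal.ofReal (Real.exp (p k - q k))
      = ENNReal.ofReal (2 * Real.exp (p k - q k)) := by
        rw [ENNReal.ofReal_mul zero_le_two, ENNReal.ofReal_ofNat]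
    _ ≤ ENNReal.ofReal (Real.exp (2 * p k)) + ENNReal.ofReal (Real.exp (-(2 * q k))) :=
        (ENNReal.ofReal_le_ofReal hexp).trans ENNReal.ofReal_add_le
    _ ≤ _ := add_le_add (ofReal_exp_le_supExp (fun k => 2 * p k) k)
        (ofReal_exp_le_supExp (fun k => -(2 * q k)) k)

theorem supExp_add_abs_add_supExp_sub_abs_le (a b : κ → ℝ) :
    supExp (fun k => a k + |b k|) + supExp (fun k => a k - |b k|) ≤
      supExp (fun k => a k + b k) + supExp (fun k => a k - b k) := by
  cases isEmpty_or_nonempty κ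
  · simp [supExp]
  refine ENNReal.iSup_add_iSup_le fun k l => ?_
  rcases le_total 0 (b k) with h | h
  · refine add_le_add (le_iSup_of_le k ?_) (le_iSup_of_le l ?_) <;> gcongr
    · exact (congrArg _ (abs_of_nonneg h)).le
    · exact sub_le_sub_left (le_abs_self (b l)) (a l)
  · rw [add_comm (supExp _)]
    refine add_le_add (le_iSup_of_le k ?_) (le_iSup_of_le l ?_) <;> gcongr
    · exact (congrArg _ (abs_of_nonpos h)).trans (sub_eq_add_neg _ _).symm |>.le
    · linarith only [neg_abs_le (b l)]

theorem sum_signs_comp_neg {ι M : Type*} [Fintype ι] [DecidableEq ι] [AddCommMonoid M]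
    (F : (ι → ℤˣ) → M) : ∑ ε, F (-ε) = ∑ ε, F ε :=
  Equiv.sum_comp (Equiv.neg (ι → ℤˣ)) F

theorem sum_signs_succ {M : Type*} [AddCommMonoid M] {m : ℕ} (F : (Fin (m + 1) → ℤˣ) → M) :
    ∑ ε, F ε = ∑ ε : Fin m → ℤˣ, (F (Fin.cons 1 ε) + F (Fin.cons (-1) ε)) := by
  rw [← (Fin.consEquiv fun _ => ℤˣ).sum_comp, Fintype.sum_prod_type_right]
  simp [UnitsInt.univ, Fin.consEquiv]

theorem sum_signs_supExp_add_sum_abs_le {m : ℕ} (a : κ → ℝ) (t : κ → Fin m → ℝ) :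
    ∑ ε : Fin m → ℤˣ, supExp (fun k => a k + ∑ i, ε i • |t k i|) ≤
      ∑ ε : Fin m → ℤˣ, supExp (fun k => a k + ∑ i, ε i • t k i) := by
  induction m generalizing a with
  | zero => simp
  | succ m ih =>
    simp only [sum_signs_succ, Fin.sum_univ_succ, Fin.cons_zero, Fin.cons_succ, one_smul,
      Units.neg_smul, ← add_assoc, ← sub_eq_add_neg]
    calc _ ≤ ∑ ε : Fin m → ℤˣ, (supExp (fun k => a k + |t k 0| + ∑ i, ε i • t k i.succ) +
          supExp (fun k => a k - |t k 0| + ∑ i, ε i • t k i.succ)) := by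
          simp only [Finset.sum_add_distrib]
          exact add_le_add (ih _ fun k i => t k i.succ) (ih _ fun k i => t k i.succ)
      _ ≤ _ := Finset.sum_le_sum fun ε _ => by
          simpa only [add_right_comm, add_sub_right_comm] using
            supExp_add_abs_add_supExp_sub_abs_le (fun k => a k + ∑ i, ε i • t k i.succ)
              fun k => t k 0

theorem sum_signs_supExp_mul_sum_abs_le {m : ℕ} (a : ℝ) (t : κ → Fin m → ℝ) :
    ∑ ε : Fin m → ℤˣ, supExp (fun k => a * ∑ i, ε i • |t k i|) ≤
      ∑ ε : Fin m → ℤˣ, supExp (fun k => a * ∑ i, ε i • t k i) := by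
  wlog ha : 0 ≤ a generalizing a
  · have h := this (-a) (by linarith)
    rw [← sum_signs_comp_neg, ← sum_signs_comp_neg fun ε => supExp fun k => -a * ∑ i, ε i • t k i]
      at h
    simpa only [Pi.neg_apply, Units.neg_smul, Finset.sum_neg_distrib, neg_mul_neg] using h
  have h := sum_signs_supExp_add_sum_abs_le 0 fun k i => a * t k i
  simpa only [Pi.zero_apply, zero_add, abs_mul, abs_of_nonneg ha, Finset.mul_sum,
    mul_smul_comm] using h

section Symmetrization

variable [Countable κ]

@[fun_prop]
theorem measurable_supExp {Ω : Type*} [MeasurableSpace Ω] {g : Ω → κ → ℝ}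
    (hg : ∀ k, Measurable fun x => g x k) : Measurable fun x => supExp (g x) :=
  .iSup fun k => (hg k).exp.ennreal_ofReal

theorem lintegral_supExp_sub_integral_le {Ω : Type*} [MeasurableSpace Ω] (μ : Measure Ω)
    [IsProbabilityMeasure μ] {h : κ → Ω → ℝ} (hm : ∀ k, Measurable (h k))
    (hi : ∀ k, Integrable (h k) μ) :
    ∫⁻ x, supExp (fun k => h k x - ∫ y, h k y ∂μ) ∂μ ≤
      ∫⁻ p, supExp (fun k => h k p.1 - h k p.2) ∂μ.prod μ := by
  rw [lintegral_prod _ (by fun_prop)]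
  refine lintegral_mono fun x => iSup_le fun k => ?_
  have hint : Integrable (fun y => h k x - h k y) μ := (integrable_const _).sub (hi k)
  calc ENNReal.ofReal (Real.exp (h k x - ∫ y, h k y ∂μ))
      = ENNReal.ofReal (Real.exp (∫ y, (h k x - h k y) ∂μ)) := by
        simp [integral_sub (integrable_const _) (hi k)]
    _ ≤ ∫⁻ y, ENNReal.ofReal (Real.exp (h k x - h k y)) ∂μ := ofReal_exp_integral_le hint
    _ ≤ _ := lintegral_mono fun y => ofReal_exp_le_supExp (fun k => h k x - h k y) k

variable {X : Type*} [MeasurableSpace X] (μ : Measure X) [IsProbabilityMeasure μ] {m : ℕ}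
  {f : κ → X → ℝ}

theorem lintegral_supExp_sum_sub_swap (hf : ∀ k, Measurable (f k)) (a : ℝ) (ε : Fin m → ℤˣ) :
    ∫⁻ p, supExp (fun k => a * ∑ i, (f k (p i).1 - f k (p i).2))
        ∂Measure.pi (fun _ : Fin m => μ.prod μ) =
      ∫⁻ p, supExp (fun k => a * ∑ i, ε i • (f k (p i).1 - f k (p i).2))
        ∂Measure.pi (fun _ : Fin m => μ.prod μ) := by
  let swap (i : Fin m) : X × X → X × X := if ε i = 1 then id else Prod.swap
  have hswap : MeasurePreserving (fun p i => swap i (p i))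
      (Measure.pi fun _ : Fin m => μ.prod μ) (Measure.pi fun _ : Fin m => μ.prod μ) := by
    refine measurePreserving_pi _ _ fun i => ?_
    by_cases h : ε i = 1
    · simpa only [swap, if_pos h] using .id _
    · simpa only [swap, if_neg h] using Measure.measurePreserving_swap
  have hsign (k : κ) (p : Fin m → X × X) (i : Fin m) :
      f k (swap i (p i)).1 - f k (swap i (p i)).2 = ε i • (f k (p i).1 - f k (p i).2) := by
    rcases Int.units_eq_one_or (ε i) with h | h <;> simp [swap, h]
  rw [← hswap.lintegral_comp (by fun_prop)]
  simp only [hsign]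

theorem two_mul_lintegral_supExp_sum_sub_le (hf : ∀ k, Measurable (f k)) (a : ℝ)
    (ε : Fin m → ℤˣ) :
    2 * ∫⁻ p, supExp (fun k => a * ∑ i, (f k (p i).1 - f k (p i).2))
        ∂Measure.pi (fun _ : Fin m => μ.prod μ) ≤
      ∫⁻ x, supExp (fun k => 2 * a * ∑ i, ε i • f k (x i)) ∂Measure.pi (fun _ => μ) +
        ∫⁻ x, supExp (fun k => 2 * a * ∑ i, (-ε) i • f k (x i)) ∂Measure.pi (fun _ => μ) := by
  have hfst : MeasurePreserving (fun (p : Fin m → X × X) i => (p i).1)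
      (Measure.pi fun _ => μ.prod μ) (Measure.pi fun _ => μ) :=
    measurePreserving_pi _ _ fun _ => measurePreserving_fst
  have hsnd : MeasurePreserving (fun (p : Fin m → X × X) i => (p i).2)
      (Measure.pi fun _ => μ.prod μ) (Measure.pi fun _ => μ) :=
    measurePreserving_pi _ _ fun _ => measurePreserving_snd
  rw [lintegral_supExp_sum_sub_swap μ hf a ε, ← lintegral_const_mul _ (by fun_prop),
    ← hfst.lintegral_comp (by fun_prop), ← hsnd.lintegral_comp (by fun_prop),
    ← lintegral_add_left (by fun_prop)]
  refine lintegral_mono fun p => ?_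
  simpa only [smul_sub, Finset.sum_sub_distrib, mul_sub, Pi.neg_apply, Units.neg_smul,
    Finset.sum_neg_distrib, mul_neg, mul_assoc] using
    two_mul_supExp_sub_le (fun k => a * ∑ i, ε i • f k (p i).1) fun k => a * ∑ i, ε i • f k (p i).2

theorem lintegral_supExp_sum_sub_integral_le (hf : ∀ k, Measurable (f k))
    (hi : ∀ k, Integrable (f k) μ) (a : ℝ) :
    ∫⁻ x, supExp (fun k => a * ∑ i, (f k (x i) - ∫ y, f k y ∂μ))
        ∂Measure.pi (fun _ : Fin m => μ) ≤
      ∫⁻ p, supExp (fun k => a * ∑ i, (f k (p i).1 - f k (p i).2))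
        ∂Measure.pi (fun _ : Fin m => μ.prod μ) := by
  have hcomp (k : κ) (i : Fin m) : Integrable (fun x : Fin m → X => f k (x i))
      (Measure.pi fun _ => μ) :=
    (measurePreserving_eval _ i).integrable_comp_of_integrable (hi k)
  have hmean (k : κ) : ∫ x, a * ∑ i, f k (x i) ∂Measure.pi (fun _ : Fin m => μ) =
      a * ∑ _i : Fin m, ∫ y, f k y ∂μ := by
    rw [integral_const_mul, integral_finsetSum _ fun i _ => hcomp k i]
    congr! 2 with i
    exact integral_comp_eval (μ := fun _ : Fin m => μ) (hf k).aestronglyMeasurable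
  have h := lintegral_supExp_sub_integral_le (Measure.pi fun _ : Fin m => μ)
    (h := fun k x => a * ∑ i, f k (x i)) (by fun_prop)
    fun k => (integrable_finsetSum _ fun i _ => hcomp k i).const_mul a
  rw [← (measurePreserving_arrowProdEquivProdArrow X X (Fin m) (fun _ => μ)
    fun _ => μ).lintegral_comp (by fun_prop)] at h
  simp only [hmean, ← mul_sub, ← Finset.sum_sub_distrib] at h
  exact h

theorem card_signs_mul_lintegral_supExp_le (hf : ∀ k, Measurable (f k))
    (hi : ∀ k, Integrable (f k) μ) (a : ℝ) :
    Fintype.card (Fin m → ℤˣ) * ∫⁻ x, supExp (fun k => a * ∑ i, (f k (x i) - ∫ y, f k y ∂μ))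
        ∂Measure.pi (fun _ : Fin m => μ) ≤
      ∑ ε : Fin m → ℤˣ, ∫⁻ x, supExp (fun k => 2 * a * ∑ i, ε i • f k (x i))
        ∂Measure.pi (fun _ => μ) := by
  set L := ∫⁻ x, supExp (fun k => a * ∑ i, (f k (x i) - ∫ y, f k y ∂μ))
    ∂Measure.pi (fun _ : Fin m => μ)
  let J (ε : Fin m → ℤˣ) : ENNReal :=
    ∫⁻ x, supExp (fun k => 2 * a * ∑ i, ε i • f k (x i)) ∂Measure.pi (fun _ => μ)
  have hpair (ε : Fin m → ℤˣ) : 2 * L ≤ J ε + J (-ε) :=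
    (mul_le_mul_right (lintegral_supExp_sum_sub_integral_le μ hf hi a) 2).trans
      (two_mul_lintegral_supExp_sum_sub_le μ hf a ε)
  have htwo : 2 * (Fintype.card (Fin m → ℤˣ) * L) ≤ 2 * ∑ ε, J ε :=
    calc 2 * (Fintype.card (Fin m → ℤˣ) * L) = ∑ _ε : Fin m → ℤˣ, 2 * L := by
          rw [Finset.sum_const, Finset.card_univ, nsmul_eq_mul, mul_left_comm]
      _ ≤ ∑ ε, (J ε + J (-ε)) := Finset.sum_le_sum fun ε _ => hpair ε
      _ = 2 * ∑ ε, J ε := by rw [Finset.sum_add_distrib, sum_signs_comp_neg, two_mul]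
  exact (ENNReal.mul_le_mul_iff_right two_ne_zero ENNReal.ofNat_ne_top).1 htwo

end Symmetrization

end SupExp

section GaussianReal

theorem lintegral_exp_mul_gaussianReal (v : NNReal) (t : ℝ) :
    ∫⁻ y, ENNReal.ofReal (Real.exp (t * y)) ∂gaussianReal 0 v =
      ENNReal.ofReal (Real.exp (v * t ^ 2 / 2)) := by
  rw [← ofReal_integral_eq_lintegral_ofReal (integrable_exp_mul_gaussianReal t)
    (.of_forall fun _ => (Real.exp_pos _).le)]
  have hmgf := congrFun (mgf_id_gaussianReal (μ := 0) (v := v)) t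
  rw [zero_mul, zero_add] at hmgf
  exact congrArg ENNReal.ofReal hmgf

theorem integral_abs_gaussianReal : ∫ y, |y| ∂gaussianReal 0 1 = √(2 / Real.pi) := by
  have hdensity (x : ℝ) : gaussianPDFReal 0 1 x • |x| =
      (√(2 * Real.pi))⁻¹ * (|x| ^ (1 : ℝ) * Real.exp (-(1 / 2) * |x| ^ (2 : ℝ))) := by
    simp only [gaussianPDFReal, NNReal.coe_one, sub_zero, mul_one, smul_eq_mul, Real.rpow_one,
      Real.rpow_ofNat, sq_abs]
    ring_nf
  have hhalf : ∫ x in Set.Ioi (0 : ℝ), x ^ (1 : ℝ) * Real.exp (-(1 / 2) * x ^ (2 : ℝ)) = 1 := by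
    rw [integral_rpow_mul_exp_neg_mul_rpow two_pos (by norm_num) (by norm_num)]
    norm_num
  calc ∫ y, |y| ∂gaussianReal 0 1 = (√(2 * Real.pi))⁻¹ * 2 := by
        rw [integral_gaussianReal_eq_integral_smul one_ne_zero]
        simp_rw [hdensity]
        rw [integral_const_mul, integral_comp_abs
          (f := fun x => x ^ (1 : ℝ) * Real.exp (-(1 / 2) * x ^ (2 : ℝ))), hhalf, mul_one]
    _ = √(2 / Real.pi) := by
        rw [Real.sqrt_div zero_le_two, Real.sqrt_mul zero_le_two]
        field_simp
        exact (Real.sq_sqrt zero_le_two).symm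

end GaussianReal

section StdGaussian

variable {E : Type*} [NormedAddCommGroup E] [InnerProductSpace ℝ E] [FiniteDimensional ℝ E]
  [MeasurableSpace E] [BorelSpace E]

theorem map_inner_stdGaussian (z : E) :
    (stdGaussian E).map (fun x => inner ℝ x z) = gaussianReal 0 (‖z‖₊ ^ 2) := by
  have hz : (fun x => inner ℝ x z) = innerSL ℝ z := funext fun x => real_inner_comm z x
  rw [hz, IsGaussian.map_eq_gaussianReal, integral_strongDual_stdGaussian,
    variance_dual_stdGaussian, innerSL_apply_norm, Real.toNNReal_pow (norm_nonneg z),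
    norm_toNNReal]

theorem integrable_abs_inner_stdGaussian (z : E) :
    Integrable (fun x => |inner ℝ x z|) (stdGaussian E) :=
  (IsGaussian.integrable_id.inner_const (𝕜 := ℝ) z).abs

theorem integral_abs_inner_stdGaussian (z : E) :
    ∫ x, |inner ℝ x z| ∂stdGaussian E = √(2 / Real.pi) * ‖z‖ := by
  have hscale : gaussianReal 0 (‖z‖₊ ^ 2) = (gaussianReal 0 1).map (‖z‖ * ·) := by
    rw [gaussianReal_map_const_mul, mul_zero, mul_one]
    rfl
  calc ∫ x, |inner ℝ x z| ∂stdGaussian E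
      = ∫ y, |y| ∂(stdGaussian E).map (fun x => inner ℝ x z) := by
        rw [integral_map (by fun_prop) (by fun_prop)]
    _ = ∫ y, |‖z‖ * y| ∂gaussianReal 0 1 := by
        rw [map_inner_stdGaussian, hscale, integral_map (by fun_prop) (by fun_prop)]
    _ = √(2 / Real.pi) * ‖z‖ := by
        simp only [abs_mul, abs_norm]
        rw [integral_const_mul, integral_abs_gaussianReal, mul_comm]

theorem lintegral_exp_inner_stdGaussian (a : ℝ) (z : E) :
    ∫⁻ x, ENNReal.ofReal (Real.exp (a * inner ℝ x z)) ∂stdGaussian E =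
      ENNReal.ofReal (Real.exp (a ^ 2 * ‖z‖ ^ 2 / 2)) := by
  have h := lintegral_exp_mul_gaussianReal (‖z‖₊ ^ 2) a
  rw [← map_inner_stdGaussian, lintegral_map (by fun_prop) (by fun_prop)] at h
  rw [h, NNReal.coe_pow, coe_nnnorm, mul_comm]

variable {m : ℕ}

theorem lintegral_exp_sum_inner_stdGaussian (a : ℝ) (z : E) :
    ∫⁻ x, ENNReal.ofReal (Real.exp (a * ∑ i, inner ℝ (x i) z))
        ∂Measure.pi (fun _ : Fin m => stdGaussian E) =
      ENNReal.ofReal (Real.exp (a ^ 2 * ‖z‖ ^ 2 * m / 2)) := by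
  let g (y : E) : ENNReal := ENNReal.ofReal (Real.exp (a * inner ℝ y z))
  have hg : Measurable g := by fun_prop
  have hindep : iIndepFun (fun i (x : Fin m → E) => g (x i))
      (Measure.pi fun _ : Fin m => stdGaussian E) :=
    iIndepFun_pi fun _ => hg.aemeasurable
  have heval (i : Fin m) :
      ∫⁻ x, g (x i) ∂Measure.pi (fun _ : Fin m => stdGaussian E) =
        ENNReal.ofReal (Real.exp (a ^ 2 * ‖z‖ ^ 2 / 2)) :=
    ((measurePreserving_eval _ i).lintegral_comp hg).trans (lintegral_exp_inner_stdGaussian a z)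
  calc ∫⁻ x, ENNReal.ofReal (Real.exp (a * ∑ i, inner ℝ (x i) z))
        ∂Measure.pi (fun _ : Fin m => stdGaussian E)
      = ∫⁻ x, ∏ i, g (x i) ∂Measure.pi (fun _ : Fin m => stdGaussian E) := by
        refine lintegral_congr fun x => ?_
        rw [Finset.mul_sum, Real.exp_sum,
          ENNReal.ofReal_prod_of_nonneg fun _ _ => (Real.exp_pos _).le]
    _ = ∏ i, ∫⁻ x, g (x i) ∂Measure.pi (fun _ : Fin m => stdGaussian E) :=
        lintegral_prod_eq_prod_lintegral_of_indepFun _ _ hindep fun i => by fun_prop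
    _ = ENNReal.ofReal (Real.exp (a ^ 2 * ‖z‖ ^ 2 * m / 2)) := by
        simp only [heval, Finset.prod_const, Finset.card_univ, Fintype.card_fin]
        rw [← ENNReal.ofReal_pow (Real.exp_pos _).le, ← Real.exp_nat_mul]
        ring_nf

theorem measurePreserving_signs_smul_stdGaussian (ε : Fin m → ℤˣ) :
    MeasurePreserving (fun (x : Fin m → E) i => ε i • x i)
      (Measure.pi fun _ => stdGaussian E) (Measure.pi fun _ => stdGaussian E) := by
  refine measurePreserving_pi _ _ fun i => ?_
  rcases Int.units_eq_one_or (ε i) with h | h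
  · rw [h, show HSMul.hSMul (1 : ℤˣ) = (id : E → E) from funext (one_smul ℤˣ)]
    exact .id _
  · rw [h, show HSMul.hSMul (-1 : ℤˣ) = (Neg.neg : E → E) by
      funext x
      rw [Units.neg_smul, one_smul]]
    exact ⟨measurable_neg, stdGaussian_map (LinearIsometryEquiv.neg ℝ)⟩

variable {κ : Type*}

open Metric

variable {K : ℝ} {N : Finset E} {T : Set E}

theorem IsNorming.lintegral_supExp_sum_inner_le (h : IsNorming K (N : Set E) T)
    (hN : (N : Set E) ⊆ closedBall 0 1) (z : κ → T) (a : ℝ) :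
    ∫⁻ x, supExp (fun k => a * ∑ i, inner ℝ (x i) (z k : E))
        ∂Measure.pi (fun _ : Fin m => stdGaussian E) ≤
      N.card * ENNReal.ofReal (Real.exp ((a * K) ^ 2 * m / 2)) := by
  have hsup (x : Fin m → E) : supExp (fun k => a * ∑ i, inner ℝ (x i) (z k : E)) ≤
      ∑ v ∈ N, ENNReal.ofReal (Real.exp (a * K * ∑ i, inner ℝ (x i) v)) := by
    refine iSup_le fun k => ?_
    obtain ⟨v, hv, hle⟩ := h (a • ∑ i, innerₗ E (x i)) (z k) (z k).2
    simp only [LinearMap.smul_apply, LinearMap.sum_apply, innerₗ_apply_apply, smul_eq_mul] at hle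
    calc ENNReal.ofReal (Real.exp (a * ∑ i, inner ℝ (x i) (z k : E)))
        ≤ ENNReal.ofReal (Real.exp (a * K * ∑ i, inner ℝ (x i) v)) := by
          refine ENNReal.ofReal_le_ofReal (Real.exp_le_exp.2 ?_)
          rwa [mul_comm a K, mul_assoc K]
      _ ≤ _ := Finset.single_le_sum
          (f := fun v => ENNReal.ofReal (Real.exp (a * K * ∑ i, inner ℝ (x i) v)))
          (fun _ _ => zero_le) hv
  refine (lintegral_mono hsup).trans ?_
  rw [lintegral_finsetSum _ fun v _ => by fun_prop, ← nsmul_eq_mul]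
  refine Finset.sum_le_card_nsmul _ _ _ fun v hv => ?_
  rw [lintegral_exp_sum_inner_stdGaussian]
  have hv : ‖v‖ ^ 2 ≤ 1 := pow_le_one₀ (norm_nonneg v) (mem_closedBall_zero_iff.1 (hN hv))
  gcongr
  exact mul_le_of_le_one_right (sq_nonneg _) hv

variable [Countable κ]

theorem lintegral_supExp_sum_signs_inner_stdGaussian (z : κ → E) (a : ℝ) (ε : Fin m → ℤˣ) :
    ∫⁻ x, supExp (fun k => a * ∑ i, ε i • inner ℝ (x i) (z k))
        ∂Measure.pi (fun _ : Fin m => stdGaussian E) =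
      ∫⁻ x, supExp (fun k => a * ∑ i, inner ℝ (x i) (z k))
        ∂Measure.pi (fun _ : Fin m => stdGaussian E) := by
  have hsmul (x : E) (k : κ) (e : ℤˣ) : inner ℝ (e • x) (z k) = e • inner ℝ x (z k) := by
    rcases Int.units_eq_one_or e with rfl | rfl <;> simp
  simp only [← hsmul]
  exact (measurePreserving_signs_smul_stdGaussian ε).lintegral_comp
    (f := fun x => supExp fun k => a * ∑ i, inner ℝ (x i) (z k)) (by fun_prop)

theorem lintegral_supExp_centered_stdGaussian_le (z : κ → E) (a : ℝ) :
    ∫⁻ x, supExp (fun k => a * ∑ i, (|inner ℝ (x i) (z k)| - √(2 / Real.pi) * ‖z k‖))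
        ∂Measure.pi (fun _ : Fin m => stdGaussian E) ≤
      ∫⁻ x, supExp (fun k => 2 * a * ∑ i, inner ℝ (x i) (z k))
        ∂Measure.pi (fun _ : Fin m => stdGaussian E) := by
  have hsymm := card_signs_mul_lintegral_supExp_le (m := m) (stdGaussian E)
    (f := fun k x => |inner ℝ x (z k)|) (by fun_prop)
    (fun k => integrable_abs_inner_stdGaussian (z k)) a
  simp only [integral_abs_inner_stdGaussian] at hsymm
  have hcard : (Fintype.card (Fin m → ℤˣ) : ENNReal) ≠ 0 := by
    exact_mod_cast Fintype.card_ne_zero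
  refine (ENNReal.mul_le_mul_iff_right hcard (ENNReal.natCast_ne_top _)).1 (hsymm.trans ?_)
  calc _ = ∫⁻ x, ∑ ε : Fin m → ℤˣ, supExp (fun k => 2 * a * ∑ i, ε i • |inner ℝ (x i) (z k)|)
        ∂Measure.pi (fun _ : Fin m => stdGaussian E) :=
        (lintegral_finsetSum _ fun ε _ => by fun_prop).symm
    _ ≤ ∫⁻ x, ∑ ε : Fin m → ℤˣ, supExp (fun k => 2 * a * ∑ i, ε i • inner ℝ (x i) (z k))
        ∂Measure.pi (fun _ : Fin m => stdGaussian E) :=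
        lintegral_mono fun x => sum_signs_supExp_mul_sum_abs_le (2 * a) fun k i =>
          inner ℝ (x i) (z k)
    _ = _ := by
        rw [lintegral_finsetSum _ fun ε _ => by fun_prop]
        simp only [lintegral_supExp_sum_signs_inner_stdGaussian, Finset.sum_const,
          Finset.card_univ, nsmul_eq_mul]

theorem IsNorming.lintegral_supExp_centered_le (h : IsNorming K (N : Set E) T)
    (hN : (N : Set E) ⊆ closedBall 0 1) (z : κ → T) (a : ℝ) :
    ∫⁻ x, supExp (fun k => a * ∑ i, (|inner ℝ (x i) (z k : E)| - √(2 / Real.pi) * ‖(z k : E)‖))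
        ∂Measure.pi (fun _ : Fin m => stdGaussian E) ≤
      N.card * ENNReal.ofReal (Real.exp (2 * (a * K) ^ 2 * m)) := by
  refine (lintegral_supExp_centered_stdGaussian_le (fun k => (z k : E)) a).trans
    ((h.lintegral_supExp_sum_inner_le hN z (2 * a)).trans_eq ?_)
  ring_nf

theorem IsNorming.measure_exists_lt_le (h : IsNorming K (N : Set E) T)
    (hN : (N : Set E) ⊆ closedBall 0 1) (hK : 0 < K) (z : κ → T) {t : ℝ} (ht : 0 ≤ t) (e : ℤˣ) :
    Measure.pi (fun _ : Fin m => stdGaussian E) {x | ∃ k, m * t <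
        e • ∑ i, (|inner ℝ (x i) (z k : E)| - √(2 / Real.pi) * ‖(z k : E)‖)} ≤
      N.card * ENNReal.ofReal (Real.exp (-(t ^ 2 * m / (8 * K ^ 2)))) := by
  let dev (x : Fin m → E) (k : κ) : ℝ :=
    ∑ i, (|inner ℝ (x i) (z k : E)| - √(2 / Real.pi) * ‖(z k : E)‖)
  -- The minimiser of `2 (l K) ^ 2 m - l m t`.
  let l : ℝ := t / (4 * K ^ 2)
  let F (x : Fin m → E) : ENNReal := supExp fun k => e • l * dev x k
  let b : ENNReal := ENNReal.ofReal (Real.exp (l * (m * t)))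
  have hF : Measurable F := by fun_prop
  have hl : 0 ≤ l := by positivity
  have hsub : {x | ∃ k, m * t < e • dev x k} ⊆ {x | b ≤ F x} := by
    rintro x ⟨k, hk⟩
    refine le_trans (ENNReal.ofReal_le_ofReal (Real.exp_le_exp.2 ?_))
      (ofReal_exp_le_supExp (fun k => e • l * dev x k) k)
    rw [smul_mul_assoc, ← mul_smul_comm]
    exact mul_le_mul_of_nonneg_left hk.le hl
  calc _ ≤ Measure.pi (fun _ : Fin m => stdGaussian E) {x | b ≤ F x} := measure_mono hsub
    _ ≤ (∫⁻ x, F x ∂Measure.pi fun _ : Fin m => stdGaussian E) / b :=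
        meas_ge_le_lintegral_div hF.aemeasurable (by simp [b, Real.exp_pos]) (by simp [b])
    _ ≤ N.card * ENNReal.ofReal (Real.exp (2 * (e • l * K) ^ 2 * m)) / b :=
        ENNReal.div_le_div_right (h.lintegral_supExp_centered_le hN z (e • l)) _
    _ = N.card * ENNReal.ofReal (Real.exp (-(t ^ 2 * m / (8 * K ^ 2)))) := by
        have hsq : (e • l * K) ^ 2 = (l * K) ^ 2 := by
          rcases Int.units_eq_one_or e with rfl | rfl <;> simp
        rw [mul_div_assoc, ← ENNReal.ofReal_div_of_pos (Real.exp_pos _), ← Real.exp_sub, hsq]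
        congr 3
        simp only [l]
        field_simp
        ring

/-- The event that the average of `|⟪x i, z⟫|` deviates from its mean `√(2 / π) ‖z‖` by more than
`t` for some `z ∈ T`. -/
def deviationEvent (m : ℕ) (T : Set E) (t : ℝ) : Set (Fin m → E) :=
  {x | ∃ z ∈ T, m * t < |∑ i, (|inner ℝ (x i) z| - √(2 / Real.pi) * ‖z‖)|}

theorem IsNorming.measure_deviationEvent_le (h : IsNorming K (N : Set E) T)
    (hN : (N : Set E) ⊆ closedBall 0 1) (hK : 0 < K) {t : ℝ} (ht : 0 ≤ t) :
    Measure.pi (fun _ : Fin m => stdGaussian E) (deviationEvent m T t) ≤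
      2 * (N.card * ENNReal.ofReal (Real.exp (-(t ^ 2 * m / (8 * K ^ 2))))) := by
  let dev (x : Fin m → E) (z : E) : ℝ := ∑ i, (|inner ℝ (x i) z| - √(2 / Real.pi) * ‖z‖)
  obtain ⟨D, hD, hdense⟩ := TopologicalSpace.exists_countable_dense T
  have : Countable D := hD.to_subtype
  let tail (e : ℤˣ) : Set (Fin m → E) := {x | ∃ k : D, m * t < e • dev x (k : T)}
  have hsub : deviationEvent m T t ⊆ tail 1 ∪ tail (-1) := by
    rintro x ⟨z, hz, hlt⟩
    have hopen : IsOpen {z : T | m * t < |dev x z|} := isOpen_lt (by fun_prop) (by fun_prop)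
    obtain ⟨k, hk, hkD⟩ := hdense.inter_open_nonempty _ hopen ⟨⟨z, hz⟩, hlt⟩
    rcases lt_abs.1 (Set.mem_ofPred_eq ▸ hk) with hk | hk
    · exact .inl ⟨⟨k, hkD⟩, by rwa [one_smul]⟩
    · exact .inr ⟨⟨k, hkD⟩, by rwa [Units.neg_smul, one_smul]⟩
  have htail (e : ℤˣ) := h.measure_exists_lt_le (m := m) hN hK (fun k : D => (k : T)) ht e
  rw [two_mul]
  exact (measure_mono hsub).trans
    ((measure_union_le _ _).trans (add_le_add (htail 1) (htail (-1))))

end StdGaussian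

theorem abs_sum_centered_le_of_notMem_deviationEvent {E : Type*} [NormedAddCommGroup E]
    [InnerProductSpace ℝ E] {m : ℕ} {T : Set E} {t : ℝ} (hT : ∀ a : ℝ, ∀ z ∈ T, a • z ∈ T)
    {x : Fin m → E} (hx : x ∉ deviationEvent m (T ∩ Metric.closedBall 0 1) t) {z : E}
    (hz : z ∈ T) :
    |∑ i, (|inner ℝ (x i) z| - √(2 / Real.pi) * ‖z‖)| ≤ m * t * ‖z‖ := by
  rcases eq_or_ne z 0 with rfl | hz0
  · simp
  let dev (z : E) : ℝ := ∑ i, (|inner ℝ (x i) z| - √(2 / Real.pi) * ‖z‖)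
  have hsmul (a : ℝ) : dev (a • z) = |a| * dev z := by
    simp only [dev, inner_smul_right, abs_mul, norm_smul, Real.norm_eq_abs, Finset.mul_sum,
      mul_sub, mul_left_comm]
  have hdev : |dev (‖z‖⁻¹ • z)| ≤ m * t := by
    by_contra! hlt
    have hunit : ‖(‖z‖⁻¹ • z)‖ = 1 := norm_smul_inv_norm (𝕜 := ℝ) hz0
    exact hx ⟨_, ⟨hT _ z hz, mem_closedBall_zero_iff.2 hunit.le⟩, hlt⟩
  rwa [hsmul, abs_mul, abs_abs, abs_inv, abs_norm, inv_mul_le_iff₀' (norm_pos_iff.2 hz0)] at hdev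

section Sensing

/-- The isometry from matrices with the Frobenius norm to Euclidean space that lists the entries
of a matrix. -/
def vectorize (α β : Type*) [Fintype α] [Fintype β] :
    Matrix α β ℝ ≃ₗᵢ[ℝ] EuclideanSpace ℝ (α × β) where
  toFun Z := WithLp.toLp 2 fun p => Z p.1 p.2
  invFun x := Matrix.of fun i j => x (i, j)
  map_add' _ _ := rfl
  map_smul' _ _ := rfl
  norm_map' Z := by
    rw [← sq_eq_sq₀ (norm_nonneg _) (norm_nonneg _), EuclideanSpace.real_norm_sq_eq,
      frobenius_norm_sq_eq_sum]
    exact Fintype.sum_prod_type _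

theorem vectorize_apply {α β : Type*} [Fintype α] [Fintype β] (Z : Matrix α β ℝ) (p : α × β) :
    vectorize α β Z p = Z p.1 p.2 := rfl

theorem sensingMap_apply_eq_inner {n m : ℕ} (A : Fin m → Matrix (Fin n) (Fin n) ℝ)
    (Z : Matrix (Fin n) (Fin n) ℝ) (i : Fin m) :
    sensingMap A Z i = inner ℝ (vectorize _ _ (A i)) (vectorize _ _ Z) := by
  simp [sensingMap, vectorize_apply, PiLp.inner_apply, Matrix.trace, Matrix.mul_apply,
    Fintype.sum_prod_type_right, mul_comm]

theorem norm_toLp_one_sensingMap {n m : ℕ} (A : Fin m → Matrix (Fin n) (Fin n) ℝ)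
    (Z : Matrix (Fin n) (Fin n) ℝ) :
    ‖WithLp.toLp 1 (sensingMap A Z)‖ =
      ∑ i, |inner ℝ (vectorize _ _ (A i)) (vectorize _ _ Z)| := by
  simp only [PiLp.norm_eq_of_L1, Real.norm_eq_abs, sensingMap_apply_eq_inner]

theorem measurePreserving_curry_pi {ι κ X : Type*} [Fintype ι] [Fintype κ] [MeasurableSpace X]
    (ν : Measure X) [IsProbabilityMeasure ν] :
    MeasurePreserving (MeasurableEquiv.curry ι κ X) (Measure.pi fun _ => ν)
      (Measure.pi fun _ => Measure.pi fun _ => ν) where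
  measurable := MeasurableEquiv.measurable _
  map_eq := by
    simpa only [Measure.infinitePi_eq_pi] using
      Measure.infinitePi_map_curry fun (_ : ι) (_ : κ) => ν

theorem IsGaussianSensing.hasLaw_stdGaussian {Ω : Type*} [MeasurableSpace Ω] {μ : Measure Ω}
    {n m : ℕ} {A : Fin m → Ω → Matrix (Fin n) (Fin n) ℝ} (hA : IsGaussianSensing μ A) :
    HasLaw (fun ω i => vectorize _ _ (A i ω))
      (Measure.pi fun _ => stdGaussian (EuclideanSpace ℝ (Fin n × Fin n))) μ := by
  have hentries : HasLaw (fun ω (q : Fin m × Fin n × Fin n) => A q.1 ω q.2.1 q.2.2)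
      (Measure.pi fun _ => gaussianReal 0 1) μ :=
    hA.indep.hasLaw_pi fun q => hA.hasLaw q.1 q.2.1 q.2.2
  have htoLp : MeasurePreserving (WithLp.toLp 2 : (Fin n × Fin n → ℝ) → _)
      (Measure.pi fun _ => gaussianReal 0 1) (stdGaussian (EuclideanSpace ℝ (Fin n × Fin n))) :=
    ⟨by fun_prop, map_pi_eq_stdGaussian⟩
  exact ((measurePreserving_pi _ _ fun _ => htoLp).comp
    (measurePreserving_curry_pi (gaussianReal 0 1))).comp_hasLaw hentries

theorem exists_isNorming_vectorize_bisparseLowRank (n s r : ℕ) :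
    ∃ N : Finset (EuclideanSpace ℝ (Fin n × Fin n)),
      N.card ≤ n.choose s ^ 2 * 5 ^ (r * (s + s)) ∧
      (N : Set (EuclideanSpace ℝ (Fin n × Fin n))) ⊆ Metric.closedBall 0 1 ∧
      IsNorming 4 (N : Set (EuclideanSpace ℝ (Fin n × Fin n)))
        (vectorize _ _ '' bisparseLowRank n s r ∩ Metric.closedBall 0 1) := by
  classical
  obtain ⟨N, hcard, hball, hN⟩ := exists_isNorming_bisparseLowRank n s r
  refine ⟨N.image (vectorize _ _), Finset.card_image_le.trans hcard, ?_, ?_⟩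
  · rw [Finset.coe_image, Set.image_subset_iff]
    intro Z hZ
    simpa using hball hZ
  · rw [Finset.coe_image]
    refine (hN.image (vectorize _ _).toLinearEquiv.toLinearMap).mono subset_rfl ?_
    rintro _ ⟨⟨Z, hZ, rfl⟩, hball⟩
    exact ⟨Z, ⟨hZ, by simpa using hball⟩, rfl⟩

theorem smul_mem_bisparseLowRank {n s r : ℕ} (a : ℝ) {Z : Matrix (Fin n) (Fin n) ℝ}
    (hZ : Z ∈ bisparseLowRank n s r) : a • Z ∈ bisparseLowRank n s r := by
  obtain ⟨hr, S, T, hS, hT, hZS, hZT⟩ := hZ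
  refine ⟨?_, S, T, hS, hT, fun i hi j => ?_, fun i j hj => ?_⟩
  · rw [Matrix.smul_eq_diagonal_mul]
    exact (Matrix.rank_mul_le_right _ _).trans hr
  · simp [hZS i hi j]
  · simp [hZT i j hj]

theorem satisfiesRIP_of_notMem_deviationEvent {n m s r : ℕ} (hm : 0 < m) {δ : ℝ}
    {A : Fin m → Matrix (Fin n) (Fin n) ℝ}
    (hA : (fun i => vectorize _ _ (A i)) ∉ deviationEvent m
      (vectorize _ _ '' bisparseLowRank n s r ∩ Metric.closedBall 0 1) (δ * √(2 / Real.pi))) :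
    SatisfiesRIP (sensingMap A) s r δ := by
  intro Z hZ
  have hdev := abs_sum_centered_le_of_notMem_deviationEvent (by
    rintro a _ ⟨Z, hZ, rfl⟩
    exact ⟨a • Z, smul_mem_bisparseLowRank a hZ, map_smul _ a Z⟩) hA (Set.mem_image_of_mem _ hZ)
  rw [Finset.sum_sub_distrib, ← norm_toLp_one_sensingMap, Finset.sum_const, Finset.card_univ,
    Fintype.card_fin, nsmul_eq_mul, LinearIsometryEquiv.norm_map] at hdev
  have hm : (0 : ℝ) < m := by exact_mod_cast hm
  have hscale : √(Real.pi / 2) / m * (m * √(2 / Real.pi)) = 1 := by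
    rw [← mul_assoc, div_mul_cancel₀ _ hm.ne', ← Real.sqrt_mul (by positivity),
      div_mul_div_cancel₀ two_ne_zero, div_self Real.pi_ne_zero, Real.sqrt_one]
  have hbound : |√(Real.pi / 2) / m * ‖WithLp.toLp 1 (sensingMap A Z)‖ - ‖Z‖| ≤ δ * ‖Z‖ :=
    calc _ = |√(Real.pi / 2) / m *
          (‖WithLp.toLp 1 (sensingMap A Z)‖ - m * (√(2 / Real.pi) * ‖Z‖))| := by
          congr 1
          linear_combination ‖Z‖ * hscale
      _ = √(Real.pi / 2) / m *
          |‖WithLp.toLp 1 (sensingMap A Z)‖ - m * (√(2 / Real.pi) * ‖Z‖)| := by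
          rw [abs_mul, abs_of_nonneg (by positivity)]
      _ ≤ √(Real.pi / 2) / m * (m * (δ * √(2 / Real.pi)) * ‖Z‖) :=
          mul_le_mul_of_nonneg_left hdev (by positivity)
      _ = δ * ‖Z‖ := by linear_combination δ * ‖Z‖ * hscale
  constructor <;> linarith [abs_le.1 hbound]

theorem one_sub_le_measureReal_satisfiesRIP {Ω : Type*} [MeasurableSpace Ω] {μ : Measure Ω}
    {n m : ℕ} {A : Fin m → Ω → Matrix (Fin n) (Fin n) ℝ} (hA : IsGaussianSensing μ A)
    (hm : 0 < m) (s r : ℕ) {δ : ℝ} (hδ : 0 ≤ δ) :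
    1 - 2 * (n.choose s ^ 2 * 5 ^ (r * (s + s)) * Real.exp (-(δ ^ 2 * m / (64 * Real.pi)))) ≤
      μ.real {ω | SatisfiesRIP (sensingMap fun i => A i ω) s r δ} := by
  have hlaw := hA.hasLaw_stdGaussian
  have : IsProbabilityMeasure μ := hlaw.isProbabilityMeasure
  obtain ⟨N, hcard, hball, hN⟩ := exists_isNorming_vectorize_bisparseLowRank n s r
  let bad := deviationEvent m (vectorize _ _ '' bisparseLowRank n s r ∩ Metric.closedBall 0 1)
    (δ * √(2 / Real.pi))
  let good : Set Ω := {ω | SatisfiesRIP (sensingMap fun i => A i ω) s r δ}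
  have hexp : (δ * √(2 / Real.pi)) ^ 2 * m / (8 * 4 ^ 2) = δ ^ 2 * m / (64 * Real.pi) := by
    rw [mul_pow, Real.sq_sqrt (by positivity)]
    field_simp
    ring
  have hbad : μ goodᶜ ≤
      2 * (N.card * ENNReal.ofReal (Real.exp (-(δ ^ 2 * m / (64 * Real.pi))))) :=
    calc μ goodᶜ ≤ μ ((fun ω i => vectorize _ _ (A i ω)) ⁻¹' bad) := measure_mono fun ω hω => by
          by_contra h
          exact hω (satisfiesRIP_of_notMem_deviationEvent hm h)
      _ ≤ Measure.pi (fun _ => stdGaussian _) bad :=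
          (Measure.le_map_apply hlaw.aemeasurable _).trans_eq (by rw [hlaw.map_eq])
      _ ≤ _ := hexp ▸ hN.measure_deviationEvent_le hball four_pos (by positivity)
  have hbadReal : μ.real goodᶜ ≤ 2 * (N.card * Real.exp (-(δ ^ 2 * m / (64 * Real.pi)))) := by
    refine ENNReal.toReal_le_of_le_ofReal (by positivity) (hbad.trans_eq ?_)
    rw [ENNReal.ofReal_mul zero_le_two, ENNReal.ofReal_mul (Nat.cast_nonneg _),
      ENNReal.ofReal_ofNat, ENNReal.ofReal_natCast]
  have hcard : (N.card : ℝ) ≤ n.choose s ^ 2 * 5 ^ (r * (s + s)) := by exact_mod_cast hcard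
  have hunion : 1 ≤ μ.real good + μ.real goodᶜ := by
    simpa using measureReal_union_le (μ := μ) good goodᶜ
  calc _ ≤ 1 - 2 * (N.card * Real.exp (-(δ ^ 2 * m / (64 * Real.pi)))) := by gcongr
    _ ≤ μ.real good := by linarith

end Sensing

section Counting

variable {n s r : ℕ}

theorem choose_le_exp (hs : 1 ≤ s) (hsn : s ≤ n) :
    (n.choose s : ℝ) ≤ Real.exp (s * Real.log (Real.exp 1 * n / s)) := by
  have hs0 : (0 : ℝ) < s := by exact_mod_cast hs
  have hn0 : (0 : ℝ) < n := by exact_mod_cast hs.trans hsn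
  have hstirling : (s : ℝ) ^ s ≤ Real.exp s * s.factorial :=
    (div_le_iff₀ (by positivity)).1 (Real.pow_div_factorial_le_exp (s : ℝ) hs0.le s)
  calc (n.choose s : ℝ) ≤ n ^ s / s.factorial := Nat.choose_le_pow_div s n
    _ ≤ (Real.exp 1 * n / s) ^ s := by
      rw [div_pow, mul_pow, ← Real.exp_nat_mul, mul_one, div_le_div_iff₀ (by positivity)
        (by positivity)]
      calc (n : ℝ) ^ s * s ^ s ≤ n ^ s * (Real.exp s * s.factorial) := by gcongr
        _ = Real.exp s * n ^ s * s.factorial := by ring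
    _ = Real.exp (s * Real.log (Real.exp 1 * n / s)) := by
      rw [Real.exp_nat_mul, Real.exp_log (by positivity)]

theorem one_le_log_exp_one_mul_div (hs : 1 ≤ s) (hsn : s ≤ n) :
    1 ≤ Real.log (Real.exp 1 * n / s) := by
  have hs0 : (0 : ℝ) < s := by exact_mod_cast hs
  have hn0 : (0 : ℝ) < n := by exact_mod_cast hs.trans hsn
  rw [Real.le_log_iff_exp_le (by positivity), le_div_iff₀ hs0]
  gcongr

theorem choose_sq_mul_five_pow_le_exp (hs : 1 ≤ s) (hsn : s ≤ n) (hr : 1 ≤ r) :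
    (n.choose s : ℝ) ^ 2 * 5 ^ (r * (s + s)) ≤
      Real.exp (6 * (r * s * Real.log (Real.exp 1 * n / s))) := by
  have hlog := one_le_log_exp_one_mul_div hs hsn
  set l := Real.log (Real.exp 1 * n / s)
  have hfive : (5 : ℝ) ≤ Real.exp 2 := by
    rw [← one_add_one_eq_two, Real.exp_add]
    nlinarith [Real.exp_one_gt_d9]
  calc (n.choose s : ℝ) ^ 2 * 5 ^ (r * (s + s))
      ≤ Real.exp (s * l) ^ 2 * Real.exp 2 ^ (r * (s + s)) := by
        gcongr
        exact choose_le_exp hs hsn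
    _ = Real.exp (2 * (1 * (s * l)) + 4 * (r * s * 1)) := by
        rw [← Real.exp_nat_mul, ← Real.exp_nat_mul, ← Real.exp_add]
        push_cast
        ring_nf
    _ ≤ Real.exp (2 * (r * (s * l)) + 4 * (r * s * l)) := by
        gcongr
        exact_mod_cast hr
    _ = Real.exp (6 * (r * s * l)) := by ring_nf

theorem log_exp_one_mul_div_le (hs : 1 ≤ s) (hsn : 2 * s ≤ n) :
    Real.log (Real.exp 1 * n / s) ≤ 3 * Real.log ((n : ℝ) / s) := by
  have hs0 : (0 : ℝ) < s := by exact_mod_cast hs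
  have hratio : (2 : ℝ) ≤ n / s := by
    rw [le_div_iff₀ hs0]
    exact_mod_cast hsn
  have hlog := Real.log_le_log two_pos hratio
  rw [mul_div_assoc, Real.log_mul (Real.exp_pos 1).ne' (by positivity), Real.log_exp]
  linarith [Real.log_two_gt_d9]

theorem mul_log_exp_one_mul_div_le_of_sample_size {C δ x : ℝ} (hC : 0 ≤ C) (hδ : 0 < δ)
    (hs : 1 ≤ s) (hsn : s ≤ n)
    (hx : (2 * s ≤ n ∧ 3 * C / δ ^ 2 * (r * s * Real.log ((n : ℝ) / s)) ≤ x) ∨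
      3 * C / δ ^ 2 * (r * s * Real.log (Real.exp 1 * n / s)) ≤ x) :
    C * (r * s * Real.log (Real.exp 1 * n / s)) ≤ δ ^ 2 * x := by
  have hlog := one_le_log_exp_one_mul_div hs hsn
  rw [div_mul_eq_mul_div, div_mul_eq_mul_div, div_le_iff₀' (by positivity),
    div_le_iff₀' (by positivity)] at hx
  rcases hx with ⟨h2s, hx⟩ | hx
  · calc C * (r * s * Real.log (Real.exp 1 * n / s))
        ≤ C * (r * s * (3 * Real.log ((n : ℝ) / s))) := by
          gcongr
          exact log_exp_one_mul_div_le hs h2s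
      _ = 3 * C * (r * s * Real.log ((n : ℝ) / s)) := by ring
      _ ≤ δ ^ 2 * x := hx
  · refine le_trans ?_ hx
    gcongr
    linarith

end Counting

theorem mainTheorem6_general :
    ∃ C > (0 : ℝ), ∃ c > (0 : ℝ),
      ∀ {Ω : Type*} [MeasurableSpace Ω] (μ : Measure Ω)
        (n m s r : ℕ) (A : Fin m → Ω → Matrix (Fin n) (Fin n) ℝ) (δ : ℝ),
        IsGaussianSensing μ A → 1 ≤ s → s ≤ n → 1 ≤ r → 0 < δ →
        ((2 * s ≤ n ∧ C / δ ^ 2 * (r * s * Real.log ((n : ℝ) / s)) ≤ (m : ℝ)) ∨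
          C / δ ^ 2 * (r * s * Real.log (Real.exp 1 * n / s)) ≤ (m : ℝ)) →
        1 - 2 * Real.exp (-(c * δ ^ 2 * m)) ≤
          μ.real {ω | SatisfiesRIP (sensingMap fun i => A i ω) s r δ} := by
  refine ⟨3 * (768 * Real.pi), by positivity, 1 / (128 * Real.pi), by positivity, ?_⟩
  intro Ω _ μ n m s r A δ hA hs hsn hr hδ hm
  have hsize := mul_log_exp_one_mul_div_le_of_sample_size (by positivity) hδ hs hsn hm
  have hlog := one_le_log_exp_one_mul_div hs hsn
  have hm0 : 0 < m := by
    have : 0 < δ ^ 2 * m := lt_of_lt_of_le (by positivity) hsize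
    exact_mod_cast pos_of_mul_pos_right this (sq_nonneg δ)
  refine le_trans ?_ (one_sub_le_measureReal_satisfiesRIP hA hm0 s r hδ.le)
  gcongr
  calc (n.choose s : ℝ) ^ 2 * 5 ^ (r * (s + s)) * Real.exp (-(δ ^ 2 * m / (64 * Real.pi)))
      ≤ Real.exp (6 * (r * s * Real.log (Real.exp 1 * n / s))) *
          Real.exp (-(δ ^ 2 * m / (64 * Real.pi))) := by
        gcongr
        exact choose_sq_mul_five_pow_le_exp hs hsn hr
    _ ≤ Real.exp (-(1 / (128 * Real.pi) * δ ^ 2 * m)) := by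
        rw [← Real.exp_add, Real.exp_le_exp]
        field_simp
        linarith

theorem mainTheorem6 :
    ∃ C > (0 : ℝ), ∃ c > (0 : ℝ),
      ∀ {Ω : Type*} [MeasurableSpace Ω] (μ : Measure Ω) [IsProbabilityMeasure μ]
        (n m s r : ℕ) (A : Fin m → Ω → Matrix (Fin n) (Fin n) ℝ) (δ : ℝ),
        IsGaussianSensing μ A → 1 ≤ s → s ≤ n → 1 ≤ r → 0 < δ → δ < 1 →
        ((2 * s ≤ n ∧ C / δ ^ 2 * (r * s * Real.log ((n : ℝ) / s)) ≤ (m : ℝ)) ∨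
          C / δ ^ 2 * (r * s * Real.log (Real.exp 1 * n / s)) ≤ (m : ℝ)) →
        1 - 2 * Real.exp (-(c * δ ^ 2 * m)) ≤
          μ.real {ω | SatisfiesRIP (sensingMap fun i => A i ω) s r δ} := by
  obtain ⟨C, hC, c, hc, h⟩ := mainTheorem6_general
  exact ⟨C, hC, c, hc, fun μ _ n m s r A δ hA hs hsn hr hδ _ => h μ n m s r A δ hA hs hsn hr hδ⟩
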